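/- Notation. For a sequence $(x_m)_{m\ge1}$ in a commutative $\mathbb{Q}$-algebra, the partial Bell polynomials $B_{n,k}(x_1,x_2,\dots)$ are defined by $\sum_{n\ge k}B_{n,k}(x_1,x_2,\dots)\frac{t^n}{n!}=\frac1{k!}\bigl(\sum_{m\ge1}x_m\frac{t^m}{m!}\bigr)^k$. Let $(f_n(x))_{n\ge0}$ be a sequence of real polynomials of binomial type, i.e. $f_n(x+y)=\sum_{i=0}^n\binom ni f_i(x)f_{n-i}(y)$ for all $n,x,y$, with $f_0(x)=1$. For a real $a$ let $f_0(x;a)=1$ and, for $n\ge1$, let $f_n(x;a)$ be the polynomial $\frac{x}{an+x}f_n(an+x)$ (it is a polynomial since $f_n(0)=0$). $D^{N}_{z=c}g(z)$ denotes the $N$-th derivative of $g$ at $z=c$, and $T=T(n,k)=r(n-k)+sk$. The quotient $\frac{sk}{T}$ is read as $1$ when $s=0$ and $n=k$. Theorem 3. Let $(a_n)_{n\ge1}$ be a real sequence, let $r,s,u,v$ be non-negative integers with $r+s\ge1$, and let $a,\alpha,\beta,\lambda$ be real numbers. Then the sequence $$Y(n,k):=\binom nk\frac{sk}{T}\,T!\sum_{j\ge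 T}B_{j,T}(a_1,a_2,\dots)\,D^{ju+vT}_{z=\beta j+\lambda T}\bigl\{e^{\alpha z}f_{n-k}(z;a)\bigr\}\frac{x^j}{j!}$$ satisfies, for all integers $n\ge k\ge1$, $$B_{n,k}\bigl(Y(1,1),Y(2,1),Y(3,1),\dots\bigr)=Y(n,k).\qquad(*)$$ For $\alpha=0$ the sequence $$Y(n,k):=\frac{n!}{k!}\frac{sk}{T}\,T!\sum_{j=T}^{h+T}B_{j,T}(a_1,a_2,\dots)\,\frac{D^{ju+vT}_{z=\beta j+\lambda T}f_{(u+v)T+n-k}(z;a)}{\bigl((u+v)T+n-k\bigr)!}\frac{x^j}{j!}$$ also satisfies $(*)$, where $h=\lfloor (n-k)/u\rfloor$ if $u\ge1$ and $h=\infty$ if $u=0$. Here $x$ is either an indeterminate, and $(*)$ is an identity in $\mathbb{R}[[x]]$, or a real number. For the second sequence with $u\ge1$ the sums are finite and $x$ is an arbitrary real number. In the other cases, given a real $x$ and $n\ge k\ge1$: if the series defining $Y(m,1)$, $1\le m\le n-k+1$, converge absolutely, then so does the series defining $Y(n,k)$, and $(*)$ holds; and $(*)$ also holds if the series defining these $Y(m,1)$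 and the series defining $Y(n,k)$ merely converge. -/

import Mathlib

open scoped PowerSeries Nat

/-- The exponential partial Bell polynomial `B_{n,k}(x₁, x₂, …)` evaluated at a sequence with values
in a commutative `ℚ`-algebra, defined by its generating function
`∑_n B_{n,k}(x₁, x₂, …) tⁿ / n! = (1 / k!) (∑_{m ≥ 1} x_m t^m / m!)^k`.
The entry `x 0` is not used. -/
noncomputable def bellPartial {R : Type*} [CommRing R] [Algebra ℚ R] (n k : ℕ) (x : ℕ → R) : R :=
  ((n ! : ℚ) / (k ! : ℚ)) •
    PowerSeries.coeff n
      ((PowerSeries.mk fun m : ℕ => if m = 0 then (0 : R) else ((m ! : ℚ)⁻¹) • x m) ^ k)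

/-- A sequence of real polynomials of binomial type, normalised by `f₀ = 1`. (It is not required
that `f_n` have exact degree `n`; that it has degree at most `n` follows.) -/
def IsBinomialType (f : ℕ → Polynomial ℝ) : Prop :=
  f 0 = 1 ∧ ∀ (n : ℕ) (x y : ℝ),
    (f n).eval (x + y) =
      ∑ i ∈ Finset.range (n + 1), (n.choose i : ℝ) * (f i).eval x * (f (n - i)).eval y

/-- The polynomial `f_n(x; a) = x / (a n + x) * f_n(a n + x)`, with `f_0(x; a) = 1`. For `n ≥ 1` and
`f` of binomial type, `f_n` has no constant term, so `f_n(y) / y` is the polynomial `divX f_n`. -/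
noncomputable def shiftedSeq (f : ℕ → Polynomial ℝ) (a : ℝ) (n : ℕ) : Polynomial ℝ :=
  if n = 0 then 1
  else Polynomial.X * (f n).divX.comp (Polynomial.C (a * n) + Polynomial.X)

/-- `T = T(n,k) = r (n - k) + s k`. -/
def bigT (r s n k : ℕ) : ℕ := r * (n - k) + s * k

/-- The quotient `s k / T`. It is `0 / 0` only if `s = 0` and `n = k`; it is then read as `1`, its
value for `n = k` and any `s ≥ 1`. -/
noncomputable def ratioT (r s n k : ℕ) : ℝ :=
  if bigT r s n k = 0 then 1 else ((s : ℝ) * (k : ℝ)) / (bigT r s n k : ℝ)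

/-- The coefficient of `x ^ j` in
`Y(n,k) = C(n,k) (s k / T) T! ∑_{j ≥ T} B_{j,T}(a₁, a₂, …)
  D_{z = β j + λ T}^{j u + v T} {e^{α z} f_{n-k}(z; a)} x^j / j!`. -/
noncomputable def coeffY (f : ℕ → Polynomial ℝ) (A : ℕ → ℝ) (r s u v : ℕ) (a α β lam : ℝ)
    (n k j : ℕ) : ℝ :=
  let T := bigT r s n k
  if T ≤ j then
    (n.choose k : ℝ) * ratioT r s n k * (T ! : ℝ) *
      (bellPartial j T A *
        iteratedDeriv (j * u + v * T)
          (fun z : ℝ => Real.exp (α * z) * (shiftedSeq f a (n - k)).eval z) (β * j + lam * T) /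
        (j ! : ℝ))
  else 0

/-- The number `h`: the integer part of `(n - k) / u` if `u ≥ 1`, and `∞` if `u = 0`. -/
def boundH (u n k : ℕ) : ℕ∞ := if u = 0 then ⊤ else (((n - k) / u : ℕ) : ℕ∞)

/-- The coefficient of `x ^ j` in
`Y(n,k) = (n! / k!) (s k / T) T! ∑_{j = T}^{h + T} B_{j,T}(a₁, a₂, …)
  (D_{z = β j + λ T}^{j u + v T} f_{(u+v) T + n - k}(z; a) / ((u+v) T + n - k)!) x^j / j!`. -/
noncomputable def coeffYZero (f : ℕ → Polynomial ℝ) (A : ℕ → ℝ) (r s u v : ℕ) (a β lam : ℝ)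
    (n k j : ℕ) : ℝ :=
  let T := bigT r s n k
  if T ≤ j ∧ (j : ℕ∞) ≤ boundH u n k + (T : ℕ∞) then
    (n ! : ℝ) / (k ! : ℝ) * ratioT r s n k * (T ! : ℝ) *
      (bellPartial j T A *
        (iteratedDeriv (j * u + v * T)
          (fun z : ℝ => (shiftedSeq f a ((u + v) * T + (n - k))).eval z) (β * j + lam * T) /
          (((u + v) * T + (n - k)) ! : ℝ)) /
        (j ! : ℝ))
  else 0

/-- The array `Y(n,k)` satisfies `B_{n,k}(Y(1,1), Y(2,1), Y(3,1), …) = Y(n,k)` for `n ≥ k ≥ 1`. -/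
def SatisfiesBell {R : Type*} [CommRing R] [Algebra ℚ R] (Y : ℕ → ℕ → R) : Prop :=
  ∀ n k : ℕ, 1 ≤ k → k ≤ n → bellPartial n k (fun m => Y m 1) = Y n k

/-! The Bell identity says that `k!/n! · Y(n,k)` is the coefficient of `tⁿ` in the `k`-th power of
one series. Lagrange inversion supplies such arrays: if `w = t G(w)^r`, then `[t^m] G(w)^(sk) =
sk/(rm+sk) · [t^m] G^(rm+sk)`, and the left side comes from the `k`-th power of `G(w)^s`
(`satisfiesBell_of_pow`).

It remains to find `G`, a series in `t` over `ℝ[[x]]`, whose `T`-th power has the coefficients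
occurring in `Y`. By `lagrangeComp_egf`, `∑ f_m(z;a) t^m/m!` is again an exponential `E^z`. If `L =
log E`, then `d/dz` multiplies `e^(αz) E^z` by `α + L`. The derivative of order `ju+vT` at `βj+λT`
is therefore `P^j Q^T`, where `P = (α+L)^u (e^α E)^β` and `Q = (α+L)^v (e^α E)^λ`. With `φ = ∑ a_m
y^m/m!`, summation over `j` gives `(Q φ(xP))^T`. For `α = 0`, `t` divides `L`, and these factors `t`
shift the index of `f`.

At a real `x`, evaluation is a ring homomorphism on absolutely convergent series; Abel's limit
theorem reduces conditional convergence to this case. -/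

/-! ### Lagrange inversion for formal power series. -/

/-- The operator `H ↦ H(w(t))`, where `w = t R(w)`, written through its Lagrange coefficients
`[tⁿ] H(w) = [yⁿ] H Rⁿ⁻¹ (R - y R')`. -/
noncomputable def lagrangeComp {K : Type*} [CommRing K] (R H : K⟦X⟧) : K⟦X⟧ :=
  PowerSeries.mk fun n => match n with
    | 0 => PowerSeries.coeff 0 H
    | n + 1 => PowerSeries.coeff (n + 1)
        (H * R ^ n * (R - PowerSeries.X * PowerSeries.derivative K R))

namespace lagrangeComp

variable {K : Type*} [CommRing K]

theorem coeff_zero (R H : K⟦X⟧) :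
    PowerSeries.coeff 0 (lagrangeComp R H) = PowerSeries.coeff 0 H := by
  simp [lagrangeComp]

theorem coeff_succ (R H : K⟦X⟧) (n : ℕ) :
    PowerSeries.coeff (n + 1) (lagrangeComp R H) = PowerSeries.coeff (n + 1)
      (H * R ^ n * (R - PowerSeries.X * PowerSeries.derivative K R)) := by
  simp [lagrangeComp]

theorem add (R G H : K⟦X⟧) : lagrangeComp R (G + H) = lagrangeComp R G + lagrangeComp R H := by
  ext n
  cases n with
  | zero => simp only [map_add, coeff_zero]
  | succ n => simp only [map_add, coeff_succ, add_mul]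

theorem C_mul (R : K⟦X⟧) (c : K) (H : K⟦X⟧) :
    lagrangeComp R (PowerSeries.C c * H) = PowerSeries.C c * lagrangeComp R H := by
  ext n
  cases n with
  | zero => simp [coeff_zero]
  | succ n => simp only [PowerSeries.coeff_C_mul, coeff_succ, mul_assoc]

/-- This is the equation `w = t R(w)`, obtained by shifting coefficients. -/
theorem X_mul (R H : K⟦X⟧) :
    lagrangeComp R (PowerSeries.X * H) = PowerSeries.X * lagrangeComp R (R * H) := by
  ext n
  cases n with
  | zero => simp [coeff_zero]
  | succ n =>
    rw [coeff_succ, PowerSeries.coeff_succ_X_mul, mul_assoc, mul_assoc,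
      PowerSeries.coeff_succ_X_mul]
    cases n with
    | zero => simp [coeff_zero, mul_comm]
    | succ n => rw [coeff_succ]; congr 1; ring

/-- Multiplying by `n` loses nothing in a `ℚ`-algebra. -/
theorem natCast_mul_cancel [Algebra ℚ K] {n : ℕ} (hn : n ≠ 0) {x y : K}
    (h : (n : K) * x = n * y) : x = y := by
  have key : ∀ z : K, ((n : ℚ)⁻¹) • ((n : K) * z) = z := fun z => by
    have : (n : K) = algebraMap ℚ K n := by simp
    rw [this, ← Algebra.smul_def, smul_smul, inv_mul_cancel₀ (by exact_mod_cast hn), one_smul]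
  rw [← key x, h, key]

theorem coeff_succ_mul_derivative (G : K⟦X⟧) (n N : ℕ) :
    ((n : K) + 1) * PowerSeries.coeff (n + 1) (G ^ (N + 1)) =
      ((N : K) + 1) * PowerSeries.coeff n (G ^ N * PowerSeries.derivative K G) := by
  have h := PowerSeries.coeff_derivative (G ^ (N + 1)) n
  rw [mul_comm, ← h, Derivation.leibniz_pow]
  simp only [Nat.add_sub_cancel, smul_eq_mul, nsmul_eq_mul]
  rw [← PowerSeries.coeff_C_mul]
  simp

/-- For `n ≥ 1`, `y R^(n-1) R' = y (R^n)'/n` has the same `n`-th coefficient as `R^n`. -/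
theorem one [Algebra ℚ K] (R : K⟦X⟧) : lagrangeComp R 1 = 1 := by
  ext n
  cases n with
  | zero => simp [coeff_zero]
  | succ n =>
    rw [coeff_succ, PowerSeries.coeff_one, if_neg n.succ_ne_zero, one_mul]
    have h := coeff_succ_mul_derivative R n n
    have h' := natCast_mul_cancel (n := n + 1) n.succ_ne_zero
      (x := PowerSeries.coeff (n + 1) (R ^ (n + 1)))
      (y := PowerSeries.coeff n (R ^ n * PowerSeries.derivative K R)) (by push_cast; exact h)
    rw [mul_sub, map_sub, ← pow_succ, h', mul_left_comm, PowerSeries.coeff_succ_X_mul, sub_self]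

/-- Induction on the coefficient: write `G = c + X G'`; by `X_mul` the factor `X` comes out and
lowers the degree by one. -/
theorem mul [Algebra ℚ K] (R G H : K⟦X⟧) :
    lagrangeComp R (G * H) = lagrangeComp R G * lagrangeComp R H := by
  ext n
  induction n generalizing G H with
  | zero => simp [coeff_zero, PowerSeries.coeff_mul]
  | succ n ih =>
    have hG : G = PowerSeries.C (PowerSeries.constantCoeff G) * 1 + PowerSeries.X *
        (PowerSeries.mk fun p => PowerSeries.coeff (p + 1) G) := by
      rw [mul_one, add_comm]; exact PowerSeries.eq_X_mul_shift_add_const G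
    generalize PowerSeries.constantCoeff G = c at hG
    generalize (PowerSeries.mk fun p => PowerSeries.coeff (p + 1) G) = G' at hG
    rw [hG, add_mul, add, add, mul_assoc, C_mul, C_mul, mul_assoc, X_mul, X_mul, one, one_mul,
      add_mul, map_add, map_add, mul_one, mul_assoc, PowerSeries.coeff_succ_X_mul,
      PowerSeries.coeff_succ_X_mul, ← mul_assoc R, ih]

theorem pow [Algebra ℚ K] (R G : K⟦X⟧) (k : ℕ) :
    lagrangeComp R (G ^ k) = lagrangeComp R G ^ k := by
  induction k with
  | zero => simp [one]
  | succ k ih => rw [pow_succ, pow_succ, mul, ih]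

/-- The Lagrange–Bürmann formula, with the denominator cleared so that `r n + c = 0` needs no
exception. -/
theorem mul_coeff_pow [Algebra ℚ K] (G : K⟦X⟧) (r c n : ℕ) :
    ((r * n + c : ℕ) : K) * PowerSeries.coeff n (lagrangeComp (G ^ r) (G ^ c)) =
      (c : K) * PowerSeries.coeff n (G ^ (r * n + c)) := by
  cases n with
  | zero => simp [coeff_zero]
  | succ n =>
    rw [coeff_succ]
    cases r with
    | zero => simp
    | succ r =>
      rw [mul_sub, map_sub, Derivation.leibniz_pow]
      have h := coeff_succ_mul_derivative G n (r * n + r + n + c)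
      have e1 : G ^ c * (G ^ (r + 1)) ^ n * G ^ (r + 1) = G ^ ((r + 1) * (n + 1) + c) := by
        rw [← pow_mul, ← pow_add, ← pow_add]; congr 1; ring
      have e2 : G ^ c * (G ^ (r + 1)) ^ n * (PowerSeries.X * (r + 1) • G ^ (r + 1 - 1) •
          PowerSeries.derivative K G) = PowerSeries.X * (PowerSeries.C ((r : K) + 1) *
            (G ^ (r * n + r + n + c) * PowerSeries.derivative K G)) := by
        simp only [Nat.add_sub_cancel, smul_eq_mul, nsmul_eq_mul, map_add, map_natCast, map_one]
        have : G ^ (r * n + r + n + c) = G ^ c * (G ^ (r + 1)) ^ n * G ^ r := by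
          rw [← pow_mul, ← pow_add, ← pow_add]; congr 1; ring
        rw [this]; push_cast; ring
      rw [e1, e2, PowerSeries.coeff_succ_X_mul, PowerSeries.coeff_C_mul]
      have e3 : (r + 1) * (n + 1) + c = r * n + r + n + c + 1 := by ring
      rw [e3]
      push_cast at h ⊢
      linear_combination ((r : K) + 1) * h

end lagrangeComp

/-! ### From powers of one series to the Bell identity. -/

/-- Interchanging the two indeterminates of a double power series. -/
noncomputable def swapSeries (K : Type*) [CommRing K] : K⟦X⟧⟦X⟧ →+* K⟦X⟧⟦X⟧ where
  toFun F := PowerSeries.mk fun m => PowerSeries.mk fun j =>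
    PowerSeries.coeff m (PowerSeries.coeff j F)
  map_zero' := by ext; simp
  map_one' := by
    ext m j
    simp only [PowerSeries.coeff_mk, PowerSeries.coeff_one]
    split_ifs <;> simp [PowerSeries.coeff_one, *]
  map_add' F G := by ext; simp
  map_mul' F G := by
    ext m j
    simp only [PowerSeries.coeff_mk, PowerSeries.coeff_mul, map_sum]
    exact Finset.sum_comm

theorem coeff_coeff_swapSeries {K : Type*} [CommRing K] (F : K⟦X⟧⟦X⟧) (m j : ℕ) :
    PowerSeries.coeff j (PowerSeries.coeff m (swapSeries K F)) =
      PowerSeries.coeff m (PowerSeries.coeff j F) := by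
  simp [swapSeries]

theorem coeff_lagrangeComp_pow {K : Type*} [CommRing K] [Algebra ℝ K] [Algebra ℚ K] (G : K⟦X⟧)
    {r s : ℕ} (hrs : 1 ≤ r + s) (m : ℕ) {k : ℕ} (hk : 1 ≤ k) :
    PowerSeries.coeff m (lagrangeComp (G ^ r) (G ^ (s * k))) =
      ratioT r s (m + k) k • PowerSeries.coeff m (G ^ (r * m + s * k)) := by
  have hT : bigT r s (m + k) k = r * m + s * k := by simp [bigT]
  rcases eq_or_ne (bigT r s (m + k) k) 0 with h0 | h0
  · rw [ratioT, if_pos h0, one_smul]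
    rw [hT] at h0
    -- `T = 0` forces `s = 0` and `m = 0`; both coefficients are then `1`, which agrees with reading
    -- `0/0` as `1`.
    have hs : s = 0 := by
      rcases Nat.mul_eq_zero.1 (Nat.add_eq_zero_iff.1 h0).2 with h | h <;> omega
    have hm : m = 0 := by
      rcases Nat.mul_eq_zero.1 (Nat.add_eq_zero_iff.1 h0).1 with h | h <;> omega
    subst hs hm
    rw [lagrangeComp.coeff_zero]
    simp
  · rw [ratioT, if_neg h0, hT]
    rw [hT] at h0
    refine lagrangeComp.natCast_mul_cancel h0 ?_
    rw [lagrangeComp.mul_coeff_pow]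
    have e : ∀ (N : ℕ) (z : K), (N : K) * z = (N : ℝ) • z := fun N z => by
      rw [Algebra.smul_def, map_natCast]
    have h0' : ((r * m + s * k : ℕ) : ℝ) ≠ 0 := by exact_mod_cast h0
    rw [e, e, smul_smul, mul_div_cancel₀ _ h0']
    push_cast
    rfl

/-- Powers of a single series give rise to a solution of the Bell polynomial identity. -/
theorem satisfiesBell_of_pow {K : Type*} [CommRing K] [Algebra ℝ K] [Algebra ℚ K]
    (G : K⟦X⟧) {r s : ℕ} (hrs : 1 ≤ r + s) :
    SatisfiesBell fun n k => ((n ! : ℝ) / (k ! : ℝ) * ratioT r s n k) •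
      PowerSeries.coeff (n - k) (G ^ bigT r s n k) := by
  intro n k hk hkn
  obtain ⟨m, rfl⟩ := Nat.exists_eq_add_of_le' hkn
  have hq : ∀ (q : ℚ) (z : K), q • z = (q : ℝ) • z := fun q z => by
    rw [Algebra.smul_def, Algebra.smul_def, ← eq_ratCast (algebraMap ℚ ℝ) q]
    congr 1
    exact DFunLike.congr_fun (Subsingleton.elim (algebraMap ℚ K)
      ((algebraMap ℝ K).comp (algebraMap ℚ ℝ))) q
  -- The column `k = 1` has generating function `t G(w)^s`; its `k`-th power is `t^k G(w)^(sk)`.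
  have hser : (PowerSeries.mk fun p : ℕ => if p = 0 then (0 : K) else ((p ! : ℚ)⁻¹) •
      (((p ! : ℝ) / (1 ! : ℝ) * ratioT r s p 1) •
        PowerSeries.coeff (p - 1) (G ^ bigT r s p 1))) =
      PowerSeries.X * lagrangeComp (G ^ r) (G ^ s) := by
    ext p
    cases p with
    | zero => simp
    | succ p =>
      have h := coeff_lagrangeComp_pow G hrs p le_rfl
      rw [mul_one] at h
      rw [PowerSeries.coeff_succ_X_mul, h, PowerSeries.coeff_mk, if_neg p.succ_ne_zero, hq,
        smul_smul]
      have hp : ((p + 1)! : ℝ) ≠ 0 := by positivity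
      have hT : bigT r s (p + 1) 1 = r * p + s := by simp [bigT]
      rw [hT, Nat.add_sub_cancel]
      congr 1
      push_cast
      field_simp
      simp
  rw [bellPartial, hser, mul_pow, add_comm m k, PowerSeries.coeff_X_pow_mul', if_pos (by omega),
    ← lagrangeComp.pow, ← pow_mul]
  simp only [Nat.add_sub_cancel_left]
  rw [coeff_lagrangeComp_pow G hrs m hk, hq, smul_smul, add_comm m k]
  have hT : bigT r s (k + m) k = r * m + s * k := by simp [bigT]
  rw [hT]
  push_cast
  rfl

/-- The outer variable of `F` is `x` and the inner one `t`; after the swap `satisfiesBell_of_pow`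
applies over `ℝ⟦X⟧`. -/
theorem satisfiesBell_of_double_pow (F : ℝ⟦X⟧⟦X⟧) {r s : ℕ} (hrs : 1 ≤ r + s)
    (Y : ℕ → ℕ → ℕ → ℝ)
    (hY : ∀ n k j, k ≤ n → Y n k j = (n ! : ℝ) / (k ! : ℝ) * ratioT r s n k *
      PowerSeries.coeff (n - k) (PowerSeries.coeff j (F ^ bigT r s n k))) :
    SatisfiesBell fun n k => PowerSeries.mk (Y n k) := by
  have hY' : ∀ n k, k ≤ n → PowerSeries.mk (Y n k) = ((n ! : ℝ) / (k ! : ℝ) * ratioT r s n k) •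
      PowerSeries.coeff (n - k) ((swapSeries ℝ F) ^ bigT r s n k) := fun n k hkn => by
    ext j
    rw [PowerSeries.coeff_mk, hY n k j hkn, ← map_pow, map_smul, coeff_coeff_swapSeries,
      smul_eq_mul]
  intro n k hk hkn
  have h := satisfiesBell_of_pow (swapSeries ℝ F) hrs n k hk hkn
  dsimp only at h ⊢
  rw [hY' n k hkn, ← h, bellPartial, bellPartial]
  congr 4
  ext1 m
  split_ifs with hm
  · rfl
  · rw [hY' m 1 (by omega)]

/-! ### Sequences of binomial type. -/

/-- The exponential generating function `∑ f_n(z) tⁿ / n!`. -/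
noncomputable def egf (f : ℕ → Polynomial ℝ) (z : ℝ) : ℝ⟦X⟧ :=
  PowerSeries.mk fun n => (f n).eval z / (n ! : ℝ)

/-- The series `∑ f_n'(0) tⁿ / n!`, the logarithm of `egf f 1` for `f` of binomial type. -/
noncomputable def egfLog (f : ℕ → Polynomial ℝ) : ℝ⟦X⟧ :=
  PowerSeries.mk fun n => (f n).derivative.eval 0 / (n ! : ℝ)

theorem coeff_egf (f : ℕ → Polynomial ℝ) (z : ℝ) (n : ℕ) :
    PowerSeries.coeff n (egf f z) = (f n).eval z / (n ! : ℝ) := by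
  simp [egf]

theorem continuous_coeff_mul_egf (f : ℕ → Polynomial ℝ) (K : ℝ⟦X⟧) (n : ℕ) :
    Continuous fun z => PowerSeries.coeff n (K * egf f z) := by
  simp only [PowerSeries.coeff_mul, coeff_egf]
  fun_prop

theorem sum_choose_mul_div_factorial (p q : ℕ → ℝ) (n : ℕ) :
    (∑ i ∈ Finset.range (n + 1), (n.choose i : ℝ) * p i * q (n - i)) / (n ! : ℝ) =
      ∑ ij ∈ Finset.HasAntidiagonal.antidiagonal n, p ij.1 / (ij.1 ! : ℝ) * (q ij.2 / (ij.2 ! : ℝ)) := by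
  rw [Finset.Nat.sum_antidiagonal_eq_sum_range_succ
    (fun i j => p i / (i ! : ℝ) * (q j / (j ! : ℝ))), Finset.sum_div]
  refine Finset.sum_congr rfl fun i hi => ?_
  rw [Nat.cast_choose ℝ (Nat.lt_succ_iff.1 (Finset.mem_range.1 hi))]
  have h1 : (n ! : ℝ) ≠ 0 := by positivity
  have h2 : (i ! : ℝ) ≠ 0 := by positivity
  have h3 : ((n - i)! : ℝ) ≠ 0 := by positivity
  field_simp

theorem isBinomialType_iff_egf (f : ℕ → Polynomial ℝ) :
    IsBinomialType f ↔ f 0 = 1 ∧ ∀ x y, egf f (x + y) = egf f x * egf f y := by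
  refine and_congr_right fun _ => ⟨fun h x y => ?_, fun h n x y => ?_⟩
  · ext n
    rw [coeff_egf, h, PowerSeries.coeff_mul,
      sum_choose_mul_div_factorial (fun i => (f i).eval x) (fun i => (f i).eval y)]
    simp only [coeff_egf]
  · have h' := congrArg (PowerSeries.coeff n) (h x y)
    rw [coeff_egf, PowerSeries.coeff_mul] at h'
    simp only [coeff_egf] at h'
    rw [← sum_choose_mul_div_factorial (fun i => (f i).eval x) (fun i => (f i).eval y)] at h'
    have h1 : (n ! : ℝ) ≠ 0 := by positivity
    exact (div_left_inj' h1).1 h'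

namespace IsBinomialType

variable {f : ℕ → Polynomial ℝ}

theorem egf_add (hf : IsBinomialType f) (x y : ℝ) : egf f (x + y) = egf f x * egf f y :=
  ((isBinomialType_iff_egf f).1 hf).2 x y

theorem egf_zero (hf : IsBinomialType f) : egf f 0 = 1 := by
  have h := hf.egf_add 0 0
  rw [add_zero] at h
  have hne : egf f 0 ≠ 0 := fun h0 => by
    have := coeff_egf f 0 0
    rw [h0, hf.1] at this
    simp at this
  exact (mul_left_cancel₀ hne (by rw [← h, mul_one])).symm

theorem eval_zero (hf : IsBinomialType f) (n : ℕ) : (f (n + 1)).eval 0 = 0 := by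
  have h := congrArg (PowerSeries.coeff (n + 1)) hf.egf_zero
  rw [coeff_egf, PowerSeries.coeff_one, if_neg n.succ_ne_zero, div_eq_zero_iff] at h
  exact h.resolve_right (by positivity)

theorem egf_nat_mul (hf : IsBinomialType f) (n : ℕ) (x : ℝ) : egf f (n * x) = egf f x ^ n := by
  induction n with
  | zero => simp [hf.egf_zero]
  | succ n ih => rw [pow_succ, ← ih, ← hf.egf_add]; congr 1; push_cast; ring

theorem egf_mul_neg (hf : IsBinomialType f) (x : ℝ) : egf f x * egf f (-x) = 1 := by
  rw [← hf.egf_add, add_neg_cancel, hf.egf_zero]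

/-- The logarithmic derivative of `egf f z` is linear in `z`. -/
theorem exists_derivative_egf (hf : IsBinomialType f) : ∃ p : ℝ⟦X⟧, ∀ z : ℝ,
    PowerSeries.derivative ℝ (egf f z) = PowerSeries.C z * (p * egf f z) := by
  set U : ℝ → ℝ⟦X⟧ := fun z => PowerSeries.derivative ℝ (egf f z) * egf f (-z) with hU
  have hadd : ∀ x y, U (x + y) = U x + U y := fun x y => by
    simp only [hU]
    rw [hf.egf_add, neg_add, hf.egf_add, Derivation.leibniz, smul_eq_mul, smul_eq_mul]
    linear_combination (PowerSeries.derivative ℝ (egf f y) * egf f (-y)) * hf.egf_mul_neg x +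
      (PowerSeries.derivative ℝ (egf f x) * egf f (-x)) * hf.egf_mul_neg y
  -- Each coefficient of `U` is additive and continuous in `z`, hence linear.
  have hlin : ∀ z, U z = PowerSeries.C z * U 1 := fun z => by
    ext n
    let ℓ : ℝ →+ ℝ := AddMonoidHom.mk' (fun z => PowerSeries.coeff n (U z)) fun x y => by
      rw [hadd, map_add]
    have hc : Continuous ℓ := by
      change Continuous fun z => PowerSeries.coeff n (U z)
      simp only [hU, PowerSeries.coeff_mul, PowerSeries.coeff_derivative, coeff_egf]
      fun_prop
    have h := map_real_smul ℓ hc z 1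
    rw [smul_eq_mul, mul_one, smul_eq_mul] at h
    rw [PowerSeries.coeff_C_mul]
    exact h
  refine ⟨U 1, fun z => ?_⟩
  rw [← mul_assoc, ← hlin]
  simp only [hU]
  linear_combination (-PowerSeries.derivative ℝ (egf f z)) * hf.egf_mul_neg z

/-- With `z = (n+1)a + x`, the Lagrange coefficient is `f_(n+1)(z)/(n+1)!` times `1 - (n+1)a/z =
x/z`. -/
theorem lagrangeComp_egf (hf : IsBinomialType f) (a x : ℝ) :
    lagrangeComp (egf f a) (egf f x) = egf (shiftedSeq f a) x := by
  obtain ⟨p, hp⟩ := hf.exists_derivative_egf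
  ext n
  cases n with
  | zero => rw [lagrangeComp.coeff_zero, coeff_egf, coeff_egf, hf.1]; simp [shiftedSeq]
  | succ n =>
    have hfac : ((n + 1)! : ℝ) ≠ 0 := by positivity
    have hdivX : ∀ z, (f (n + 1)).eval z = z * (f (n + 1)).divX.eval z := fun z => by
      conv_lhs => rw [← Polynomial.X_mul_divX_add (f (n + 1))]
      have h0 : (f (n + 1)).coeff 0 = 0 := by
        rw [Polynomial.coeff_zero_eq_eval_zero, hf.eval_zero]
      simp [h0]
    -- Division by `z` proves this for `z ≠ 0`; continuity adds `z = 0`, which `(n+1)a + x` may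
    -- equal.
    have hW : (fun z => PowerSeries.coeff n (p * egf f z)) =
        fun z => (n + 1) * ((f (n + 1)).divX.eval z / ((n + 1)! : ℝ)) := by
      refine Continuous.ext_on (dense_compl_singleton (0 : ℝ)) (continuous_coeff_mul_egf f p n)
        (by fun_prop) fun z hz => ?_
      have h := congrArg (PowerSeries.coeff n) (hp z)
      rw [PowerSeries.coeff_derivative, PowerSeries.coeff_C_mul, coeff_egf, hdivX] at h
      refine mul_left_cancel₀ (show z ≠ 0 from hz) ?_
      rw [← h]
      ring
    rw [lagrangeComp.coeff_succ, hp, mul_sub, ← hf.egf_nat_mul, ← hf.egf_add, ← hf.egf_add]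
    have e : egf f (x + n * a) * (PowerSeries.X * (PowerSeries.C a * (p * egf f a))) =
        PowerSeries.X * (PowerSeries.C a * (p * egf f (x + n * a + a))) := by
      rw [hf.egf_add (x + n * a)]; ring
    rw [e, map_sub, PowerSeries.coeff_succ_X_mul, PowerSeries.coeff_C_mul, coeff_egf, coeff_egf,
      congrFun hW, hdivX]
    have hz : a * ((n + 1 : ℕ) : ℝ) + x = x + n * a + a := by push_cast; ring
    simp only [shiftedSeq, if_neg n.succ_ne_zero, Polynomial.eval_mul, Polynomial.eval_X,
      Polynomial.eval_comp, Polynomial.eval_add, Polynomial.eval_C, hz]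
    field_simp
    ring

theorem shiftedSeq (hf : IsBinomialType f) (a : ℝ) : IsBinomialType (shiftedSeq f a) := by
  refine (isBinomialType_iff_egf _).2 ⟨by simp [_root_.shiftedSeq], fun x y => ?_⟩
  rw [← hf.lagrangeComp_egf, ← hf.lagrangeComp_egf, ← hf.lagrangeComp_egf, hf.egf_add,
    lagrangeComp.mul]

/-- The addition law `E^w = E^(w-z) E^z` moves the derivative from `z` to `0`. -/
theorem hasDerivAt_coeff_egf (hf : IsBinomialType f) (n : ℕ) (z : ℝ) :
    HasDerivAt (fun z => PowerSeries.coeff n (egf f z))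
      (PowerSeries.coeff n (egfLog f * egf f z)) z := by
  have h0 : ∀ i, HasDerivAt (fun w => PowerSeries.coeff i (egf f (w - z)))
      (PowerSeries.coeff i (egfLog f)) z := fun i => by
    have h : HasDerivAt (fun w => PowerSeries.coeff i (egf f w))
        (PowerSeries.coeff i (egfLog f)) (z - z) := by
      rw [sub_self]
      simp only [coeff_egf, egfLog, PowerSeries.coeff_mk]
      exact ((f i).hasDerivAt 0).div_const _
    exact h.comp_sub_const z z
  have e : (fun w => PowerSeries.coeff n (egf f w)) = fun w =>
      ∑ ij ∈ Finset.HasAntidiagonal.antidiagonal n, PowerSeries.coeff ij.1 (egf f (w - z)) *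
        PowerSeries.coeff ij.2 (egf f z) := by
    ext w
    rw [← PowerSeries.coeff_mul, ← hf.egf_add, sub_add_cancel]
  rw [e, PowerSeries.coeff_mul]
  exact HasDerivAt.fun_sum fun ij _ => (h0 ij.1).mul_const _

theorem hasDerivAt_coeff_mul_exp_egf (hf : IsBinomialType f) (α : ℝ) (K : ℝ⟦X⟧) (n : ℕ) (z : ℝ) :
    HasDerivAt
      (fun z => PowerSeries.coeff n (K * (PowerSeries.C (Real.exp (α * z)) * egf f z)))
      (PowerSeries.coeff n (K * (PowerSeries.C α + egfLog f) *
        (PowerSeries.C (Real.exp (α * z)) * egf f z))) z := by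
  have h1 : ∀ j, HasDerivAt
      (fun z => PowerSeries.coeff j (PowerSeries.C (Real.exp (α * z)) * egf f z))
      (PowerSeries.coeff j ((PowerSeries.C α + egfLog f) *
        (PowerSeries.C (Real.exp (α * z)) * egf f z))) z := fun j => by
    have hexp : HasDerivAt (fun z => Real.exp (α * z)) (α * Real.exp (α * z)) z := by
      have := ((hasDerivAt_id z).const_mul α).exp
      simpa [mul_comm] using this
    have h := hexp.mul (hf.hasDerivAt_coeff_egf j z)
    simp only [PowerSeries.coeff_C_mul]
    refine HasDerivAt.congr_deriv h ?_
    rw [add_mul, map_add, mul_left_comm (egfLog f)]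
    simp only [PowerSeries.coeff_C_mul]
    ring
  rw [mul_assoc]
  simp only [PowerSeries.coeff_mul n K]
  exact HasDerivAt.fun_sum fun ij _ => (h1 ij.2).const_mul _

theorem iteratedDeriv_exp_mul (hf : IsBinomialType f) (α : ℝ) (n N : ℕ) (c : ℝ) :
    iteratedDeriv N (fun z => Real.exp (α * z) * (f n).eval z) c =
      (n ! : ℝ) * PowerSeries.coeff n ((PowerSeries.C α + egfLog f) ^ N *
        (PowerSeries.C (Real.exp (α * c)) * egf f c)) := by
  have hfac : (n ! : ℝ) ≠ 0 := by positivity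
  have h0 : (fun z => Real.exp (α * z) * (f n).eval z) = fun z => (n ! : ℝ) *
      PowerSeries.coeff n (1 * (PowerSeries.C (Real.exp (α * z)) * egf f z)) := by
    ext z
    rw [one_mul, PowerSeries.coeff_C_mul, coeff_egf]
    field_simp
  have h : ∀ N, iteratedDeriv N (fun z => Real.exp (α * z) * (f n).eval z) = fun z => (n ! : ℝ) *
      PowerSeries.coeff n ((PowerSeries.C α + egfLog f) ^ N *
        (PowerSeries.C (Real.exp (α * z)) * egf f z)) := fun N => by
    induction N with
    | zero => rw [iteratedDeriv_zero, h0, pow_zero]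
    | succ N ih =>
      rw [iteratedDeriv_succ, ih]
      ext z
      rw [pow_succ]
      exact ((hf.hasDerivAt_coeff_mul_exp_egf α _ n z).const_mul _).deriv
  exact congrFun (h N) c

theorem X_dvd_egfLog (hf : IsBinomialType f) : PowerSeries.X ∣ egfLog f := by
  rw [PowerSeries.X_dvd_iff, ← PowerSeries.coeff_zero_eq_constantCoeff_apply]
  simp [egfLog, hf.1]

end IsBinomialType

/-! ### The two arrays as coefficients of powers of a double series. -/

/-- The series `∑ a_m t^m / m!` whose powers define the Bell polynomials. -/
noncomputable def bellSeries (A : ℕ → ℝ) : ℝ⟦X⟧ :=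
  PowerSeries.mk fun m : ℕ => if m = 0 then (0 : ℝ) else ((m ! : ℚ)⁻¹) • A m

theorem factorial_mul_bellPartial (A : ℕ → ℝ) (j T : ℕ) :
    (T ! : ℝ) * bellPartial j T A = (j ! : ℝ) * PowerSeries.coeff j (bellSeries A ^ T) := by
  have hT : (T ! : ℝ) ≠ 0 := by positivity
  rw [bellPartial, bellSeries, Rat.smul_def]
  push_cast
  field_simp

theorem X_dvd_bellSeries (A : ℕ → ℝ) : PowerSeries.X ∣ bellSeries A := by
  rw [PowerSeries.X_dvd_iff, ← PowerSeries.coeff_zero_eq_constantCoeff_apply]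
  simp [bellSeries]

theorem coeff_bellSeries_pow_of_lt (A : ℕ → ℝ) {j T : ℕ} (h : j < T) :
    PowerSeries.coeff j (bellSeries A ^ T) = 0 :=
  PowerSeries.X_pow_dvd_iff.1 (pow_dvd_pow_of_dvd (X_dvd_bellSeries A) T) j h

theorem coeff_rescale_map_C {K : Type*} [CommRing K] (P : K⟦X⟧) (ψ : K⟦X⟧) (T j : ℕ) :
    PowerSeries.coeff j (PowerSeries.rescale P (PowerSeries.map PowerSeries.C ψ) ^ T) =
      P ^ j * PowerSeries.C (PowerSeries.coeff j (ψ ^ T)) := by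
  rw [← map_pow, ← map_pow, PowerSeries.coeff_rescale, PowerSeries.coeff_map]

theorem egf_linear_comb {g : ℕ → Polynomial ℝ} (hg : IsBinomialType g) (β lam : ℝ) (j T : ℕ) :
    egf g (β * j + lam * T) = egf g β ^ j * egf g lam ^ T := by
  rw [hg.egf_add, mul_comm β, mul_comm lam, hg.egf_nat_mul, hg.egf_nat_mul]

theorem satisfiesBell_coeffY {f : ℕ → Polynomial ℝ} (hf : IsBinomialType f) (A : ℕ → ℝ)
    {r s : ℕ} (u v : ℕ) (hrs : 1 ≤ r + s) (a α β lam : ℝ) :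
    SatisfiesBell (fun n k => PowerSeries.mk (coeffY f A r s u v a α β lam n k)) := by
  have hg := hf.shiftedSeq a
  set g := shiftedSeq f a with hgdef
  let ρ : ℝ⟦X⟧ := PowerSeries.C α + egfLog g
  let P : ℝ⟦X⟧ := ρ ^ u * (PowerSeries.C (Real.exp (α * β)) * egf g β)
  let Q : ℝ⟦X⟧ := ρ ^ v * (PowerSeries.C (Real.exp (α * lam)) * egf g lam)
  refine satisfiesBell_of_double_pow
    (PowerSeries.C Q * PowerSeries.rescale P (PowerSeries.map PowerSeries.C (bellSeries A)))
    hrs _ fun n k j hkn => ?_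
  rw [mul_pow, ← map_pow, PowerSeries.coeff_C_mul, coeff_rescale_map_C]
  simp only [coeffY]
  set T := bigT r s n k
  split_ifs with hTj
  · have hexp : PowerSeries.C (Real.exp (α * (β * j + lam * T))) =
        (PowerSeries.C (Real.exp (α * β)) ^ j * PowerSeries.C (Real.exp (α * lam)) ^ T : ℝ⟦X⟧) := by
      rw [← map_pow, ← map_pow, ← map_mul, ← Real.exp_nat_mul, ← Real.exp_nat_mul, ← Real.exp_add]
      congr 2; ring
    have e : ρ ^ (j * u + v * T) * (PowerSeries.C (Real.exp (α * (β * j + lam * T))) *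
        egf g (β * j + lam * T)) = Q ^ T * P ^ j := by
      rw [hexp, egf_linear_comb hg]
      simp only [P, Q]
      ring
    rw [← hgdef, hg.iteratedDeriv_exp_mul, e, ← mul_assoc (Q ^ T), mul_comm (Q ^ T * P ^ j),
      PowerSeries.coeff_C_mul, Nat.cast_choose ℝ hkn]
    have hj : (j ! : ℝ) ≠ 0 := by positivity
    have hm : ((n - k)! : ℝ) ≠ 0 := by positivity
    have hk : (k ! : ℝ) ≠ 0 := by positivity
    have hB := factorial_mul_bellPartial A j T
    field_simp
    linear_combination (ratioT r s n k * PowerSeries.coeff (n - k) (Q ^ T * P ^ j)) * hB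
  · rw [coeff_bellSeries_pow_of_lt A (not_le.1 hTj)]
    simp

/-- Write `L = tω` and `φ = yχ`. At `j = T + i` the derivative carries `t^((u+v)T + ui)`. The part
`t^((u+v)T)` is absorbed by the index of `f`; `t^(ui)` remains inside `χ(x t^u P)`, and it kills the
terms with `ui > n - k`, whence the bound `h`. -/
theorem satisfiesBell_coeffYZero {f : ℕ → Polynomial ℝ} (hf : IsBinomialType f) (A : ℕ → ℝ)
    {r s : ℕ} (u v : ℕ) (hrs : 1 ≤ r + s) (a β lam : ℝ) :
    SatisfiesBell (fun n k => PowerSeries.mk (coeffYZero f A r s u v a β lam n k)) := by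
  have hg := hf.shiftedSeq a
  set g := shiftedSeq f a with hgdef
  obtain ⟨ω, hω⟩ := hg.X_dvd_egfLog
  obtain ⟨χ, hχ⟩ := X_dvd_bellSeries A
  let P : ℝ⟦X⟧ := ω ^ u * egf g β
  let Q : ℝ⟦X⟧ := ω ^ v * egf g lam
  refine satisfiesBell_of_double_pow
    (PowerSeries.X * (PowerSeries.C (P * Q) *
      PowerSeries.rescale (PowerSeries.X ^ u * P) (PowerSeries.map PowerSeries.C χ)))
    hrs _ fun n k j hkn => ?_
  simp only [coeffYZero]
  set T := bigT r s n k
  rw [mul_pow, mul_pow, ← map_pow, PowerSeries.coeff_X_pow_mul']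
  by_cases hTj : T ≤ j
  swap
  · simp [hTj]
  obtain ⟨i, rfl⟩ := Nat.exists_eq_add_of_le hTj
  have hcoeff : PowerSeries.coeff (T + i) (bellSeries A ^ T) = PowerSeries.coeff i (χ ^ T) := by
    rw [hχ, mul_pow, add_comm, PowerSeries.coeff_X_pow_mul]
  rw [if_pos hTj, Nat.add_sub_cancel_left, PowerSeries.coeff_C_mul, coeff_rescale_map_C,
    ← mul_assoc, mul_comm _ (PowerSeries.C _), PowerSeries.coeff_C_mul, ← hcoeff]
  have hB := factorial_mul_bellPartial A (T + i) T
  have e1 : (P * Q) ^ T * (PowerSeries.X ^ u * P) ^ i = PowerSeries.X ^ (u * i) *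
      (ω ^ ((T + i) * u + v * T) * egf g (β * (T + i : ℕ) + lam * T)) := by
    rw [egf_linear_comb hg]
    simp only [P, Q]
    ring
  have hbound : ((T + i : ℕ) : ℕ∞) ≤ boundH u n k + (T : ℕ∞) ↔ u * i ≤ n - k := by
    rw [boundH]
    split_ifs with hu
    · simp [hu]
    · rw [← Nat.cast_add, Nat.cast_le, add_comm T i, add_le_add_iff_right,
        Nat.le_div_iff_mul_le (Nat.pos_of_ne_zero hu), mul_comm]
  simp only [hTj, hbound, true_and]
  split_ifs with hi
  · have hD : iteratedDeriv ((T + i) * u + v * T)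
        (fun z : ℝ => (g ((u + v) * T + (n - k))).eval z) (β * (T + i : ℕ) + lam * T) =
        (((u + v) * T + (n - k))! : ℝ) * PowerSeries.coeff (n - k)
          ((P * Q) ^ T * (PowerSeries.X ^ u * P) ^ i) := by
      have h := hg.iteratedDeriv_exp_mul 0 ((u + v) * T + (n - k)) ((T + i) * u + v * T)
        (β * (T + i : ℕ) + lam * T)
      simp only [zero_mul, Real.exp_zero, one_mul, map_zero, zero_add, map_one] at h
      rw [h, e1, hω, mul_pow, mul_assoc]
      have e2 : (PowerSeries.X : ℝ⟦X⟧) ^ ((T + i) * u + v * T) =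
          PowerSeries.X ^ ((u + v) * T) * PowerSeries.X ^ (u * i) := by ring
      rw [e2, mul_assoc, add_comm _ (n - k), PowerSeries.coeff_X_pow_mul]
    rw [← hgdef, hD]
    have hj : ((T + i)! : ℝ) ≠ 0 := by positivity
    have hm : (((u + v) * T + (n - k))! : ℝ) ≠ 0 := by positivity
    have hk : (k ! : ℝ) ≠ 0 := by positivity
    field_simp
    linear_combination (ratioT r s n k * PowerSeries.coeff (n - k)
      ((P * Q) ^ T * (PowerSeries.X ^ u * P) ^ i)) * hB
  · rw [e1, PowerSeries.coeff_X_pow_mul', if_neg hi]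
    simp

/-! ### Evaluation at a real `x`. -/

theorem map_bellPartial {R S : Type*} [CommRing R] [Algebra ℚ R] [CommRing S] [Algebra ℚ S]
    (e : R →+* S) (n k : ℕ) (y : ℕ → R) :
    e (bellPartial n k y) = bellPartial n k fun m => e (y m) := by
  rw [bellPartial, bellPartial, map_rat_smul, ← PowerSeries.coeff_map, map_pow]
  congr 3
  ext m
  simp only [PowerSeries.coeff_map, PowerSeries.coeff_mk]
  split_ifs
  · exact map_zero e
  · rw [map_rat_smul]

/-- The series has a factor `X`, so `X^k` splits off its `k`-th power and only its first `n - k + 1`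
entries matter. Convergence is known for these alone. -/
theorem bellPartial_congr {R : Type*} [CommRing R] [Algebra ℚ R] {n k : ℕ} (hkn : k ≤ n)
    {y z : ℕ → R} (h : ∀ m, 1 ≤ m → m ≤ n - k + 1 → y m = z m) :
    bellPartial n k y = bellPartial n k z := by
  have hX : ∀ y : ℕ → R, (PowerSeries.mk fun m : ℕ => if m = 0 then (0 : R) else
      ((m ! : ℚ)⁻¹) • y m) = PowerSeries.X *
        PowerSeries.mk fun m : ℕ => (((m + 1)! : ℚ)⁻¹) • y (m + 1) := fun y => by
    ext m
    cases m with
    | zero => simp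
    | succ m => rw [PowerSeries.coeff_succ_X_mul]; simp
  rw [bellPartial, bellPartial, hX, hX, mul_pow, mul_pow, PowerSeries.coeff_X_pow_mul',
    PowerSeries.coeff_X_pow_mul', if_pos hkn, if_pos hkn]
  congr 1
  rw [← sub_eq_zero, ← map_sub]
  refine PowerSeries.X_pow_dvd_iff.1 (dvd_trans ?_ (sub_dvd_pow_sub_pow _ _ k)) (n - k)
    (Nat.lt_succ_self _)
  refine PowerSeries.X_pow_dvd_iff.2 fun m hm => ?_
  rw [map_sub, PowerSeries.coeff_mk, PowerSeries.coeff_mk, h (m + 1) (by omega) (by omega),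
    sub_self]

theorem continuous_bellPartial (n k : ℕ) : Continuous fun y : ℕ → ℝ => bellPartial n k y := by
  unfold bellPartial
  simp only [Rat.smul_def]
  refine continuous_const.mul ?_
  induction k generalizing n with
  | zero => simpa using continuous_const
  | succ k ih =>
    simp only [pow_succ, PowerSeries.coeff_mul, PowerSeries.coeff_mk]
    refine continuous_finsetSum _ fun ij _ => (ih ij.1).mul ?_
    split_ifs <;> fun_prop

theorem coeff_mul_mul_pow (p q : ℝ⟦X⟧) (x : ℝ) (j : ℕ) :
    PowerSeries.coeff j (p * q) * x ^ j = ∑ ij ∈ Finset.HasAntidiagonal.antidiagonal j,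
      (PowerSeries.coeff ij.1 p * x ^ ij.1) * (PowerSeries.coeff ij.2 q * x ^ ij.2) := by
  rw [PowerSeries.coeff_mul, Finset.sum_mul]
  refine Finset.sum_congr rfl fun ij h => ?_
  rw [← Finset.HasAntidiagonal.mem_antidiagonal.1 h]
  ring

theorem hasSum_coeff_C_mul_pow (c x : ℝ) :
    HasSum (fun j => PowerSeries.coeff j (PowerSeries.C c) * x ^ j) c := by
  have h : (fun j => PowerSeries.coeff j (PowerSeries.C c) * x ^ j) =
      fun j => if j = 0 then c else 0 := by
    ext j
    rw [PowerSeries.coeff_C]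
    split_ifs with hj <;> simp [hj]
  rw [h]
  exact hasSum_ite_eq 0 c

/-- The real power series that converge absolutely at `x`. -/
noncomputable def summableAt (x : ℝ) : Subalgebra ℚ ℝ⟦X⟧ where
  carrier := {p | Summable fun j => PowerSeries.coeff j p * x ^ j}
  mul_mem' {p q} hp hq := by
    simp only [Set.mem_ofPred_eq, coeff_mul_mul_pow] at hp hq ⊢
    exact (summable_norm_sum_mul_antidiagonal_of_summable_norm hp.norm hq.norm).of_norm
  add_mem' {p q} hp hq := by
    simp only [Set.mem_ofPred_eq, map_add, add_mul] at hp hq ⊢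
    exact hp.add hq
  algebraMap_mem' c := by
    rw [PowerSeries.algebraMap_apply]
    exact (hasSum_coeff_C_mul_pow (algebraMap ℚ ℝ c) x).summable

/-- Evaluation at `x` of the real power series that converge absolutely there. -/
noncomputable def evalSummable (x : ℝ) : summableAt x →+* ℝ where
  toFun p := ∑' j, PowerSeries.coeff j (p : ℝ⟦X⟧) * x ^ j
  map_one' := (hasSum_coeff_C_mul_pow 1 x).tsum_eq
  map_mul' p q := by
    have hp : Summable fun j => PowerSeries.coeff j (p : ℝ⟦X⟧) * x ^ j := p.2
    have hq : Summable fun j => PowerSeries.coeff j (q : ℝ⟦X⟧) * x ^ j := q.2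
    rw [tsum_mul_tsum_eq_tsum_sum_antidiagonal_of_summable_norm hp.norm hq.norm]
    exact tsum_congr fun j => coeff_mul_mul_pow _ _ x j
  map_zero' := by simp
  map_add' p q := by
    have hp : Summable fun j => PowerSeries.coeff j (p : ℝ⟦X⟧) * x ^ j := p.2
    have hq : Summable fun j => PowerSeries.coeff j (q : ℝ⟦X⟧) * x ^ j := q.2
    rw [← hp.tsum_add hq]
    exact tsum_congr fun j => by rw [← add_mul, ← map_add]; rfl

/-- The formal identity holds inside `summableAt x`, and `evalSummable x` commutes with Bell
polynomials. -/
theorem SatisfiesBell.hasSum {c : ℕ → ℕ → ℕ → ℝ}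
    (hc : SatisfiesBell fun n k => PowerSeries.mk (c n k)) {x : ℝ} {n k : ℕ} (hk : 1 ≤ k)
    (hkn : k ≤ n)
    (hs : ∀ m : ℕ, 1 ≤ m → m ≤ n - k + 1 → Summable fun j : ℕ => c m 1 j * x ^ j) :
    HasSum (fun j : ℕ => c n k j * x ^ j)
      (bellPartial n k fun m => ∑' j : ℕ, c m 1 j * x ^ j) := by
  -- Entries outside the relevant range may diverge; `0` replaces them.
  have hmem : ∀ m : ℕ, ∃ p : summableAt x, 1 ≤ m → m ≤ n - k + 1 →
      (p : ℝ⟦X⟧) = PowerSeries.mk (c m 1) := fun m => by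
    by_cases hm : 1 ≤ m ∧ m ≤ n - k + 1
    · refine ⟨⟨PowerSeries.mk (c m 1), ?_⟩, fun _ _ => rfl⟩
      change Summable fun j => PowerSeries.coeff j (PowerSeries.mk (c m 1)) * x ^ j
      simpa only [PowerSeries.coeff_mk] using hs m hm.1 hm.2
    · exact ⟨0, fun h1 h2 => absurd ⟨h1, h2⟩ hm⟩
  choose p hp using hmem
  have hval : ((bellPartial n k p : summableAt x) : ℝ⟦X⟧) = PowerSeries.mk (c n k) := by
    refine Eq.trans ?_ (hc n k hk hkn)
    exact (map_bellPartial (summableAt x).val.toRingHom n k p).trans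
      (bellPartial_congr hkn hp)
  have heval : evalSummable x (bellPartial n k p) =
      bellPartial n k fun m => ∑' j : ℕ, c m 1 j * x ^ j := by
    rw [map_bellPartial]
    refine bellPartial_congr hkn fun m h1 h2 => ?_
    change ∑' j, PowerSeries.coeff j (p m : ℝ⟦X⟧) * x ^ j = _
    rw [hp m h1 h2]
    simp only [PowerSeries.coeff_mk]
  generalize bellPartial n k p = q at hval heval
  have hsum : Summable fun j => PowerSeries.coeff j (q : ℝ⟦X⟧) * x ^ j := q.2
  have h := hsum.hasSum
  rw [show (∑' j, PowerSeries.coeff j (q : ℝ⟦X⟧) * x ^ j) = _ from heval, hval] at h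
  simpa only [PowerSeries.coeff_mk] using h

/-- At `x t` with `|t| < 1` the series converge absolutely, so `SatisfiesBell.hasSum` applies; let
`t → 1⁻` by Abel's theorem, Bell polynomials being continuous. -/
theorem SatisfiesBell.eq_of_tendsto {c : ℕ → ℕ → ℕ → ℝ}
    (hc : SatisfiesBell fun n k => PowerSeries.mk (c n k)) {x : ℝ} {n k : ℕ} (hk : 1 ≤ k)
    (hkn : k ≤ n) {y : ℕ → ℝ} {l : ℝ}
    (hy : ∀ m : ℕ, 1 ≤ m → m ≤ n - k + 1 →
      Filter.Tendsto (fun N : ℕ => ∑ j ∈ Finset.range N, c m 1 j * x ^ j)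
        Filter.atTop (nhds (y m)))
    (hl : Filter.Tendsto (fun N : ℕ => ∑ j ∈ Finset.range N, c n k j * x ^ j)
      Filter.atTop (nhds l)) :
    bellPartial n k y = l := by
  have hleft := Real.tendsto_tsum_powerSeries_nhdsWithin_lt hl
  -- Irrelevant entries are held at `y m`, so that `Y t → y` in the product topology.
  let Y : ℝ → ℕ → ℝ := fun t m => if 1 ≤ m ∧ m ≤ n - k + 1 then
    ∑' j, c m 1 j * x ^ j * t ^ j else y m
  have hY : Filter.Tendsto Y (nhdsWithin 1 (Set.Iio 1)) (nhds y) := by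
    refine tendsto_pi_nhds.2 fun m => ?_
    by_cases hm : 1 ≤ m ∧ m ≤ n - k + 1
    · simp only [Y, if_pos hm]
      exact Real.tendsto_tsum_powerSeries_nhdsWithin_lt (hy m hm.1 hm.2)
    · simp only [Y, if_neg hm]
      exact tendsto_const_nhds
  have hright := ((continuous_bellPartial n k).tendsto y).comp hY
  refine tendsto_nhds_unique (hright.congr' ?_) hleft
  have hev : ∀ᶠ t : ℝ in nhdsWithin 1 (Set.Iio 1), t ∈ Set.Ioo (-1 : ℝ) 1 :=
    Ioo_mem_nhdsLT (by norm_num)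
  filter_upwards [hev] with t ht
  have hpow : ∀ (d : ℝ) (j : ℕ), d * (x * t) ^ j = d * x ^ j * t ^ j := fun d j => by
    rw [mul_pow, mul_assoc]
  have h := hc.hasSum (x := x * t) hk hkn fun m h1 h2 => by
    simp only [hpow]
    exact summable_powerSeries_of_norm_lt_one (hy m h1 h2).cauchySeq
      (by rw [Real.norm_eq_abs, abs_lt]; exact ht)
  simp only [hpow] at h
  rw [h.tsum_eq]
  refine bellPartial_congr hkn fun m h1 h2 => ?_
  simp only [Y, if_pos (And.intro h1 h2)]

theorem coeffYZero_eq_zero_of_notMem (f : ℕ → Polynomial ℝ) (A : ℕ → ℝ) (r s : ℕ) {u : ℕ}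
    (v : ℕ) (a β lam : ℝ) (hu : 1 ≤ u) {n k j : ℕ}
    (hj : j ∉ Finset.Icc (bigT r s n k) ((n - k) / u + bigT r s n k)) :
    coeffYZero f A r s u v a β lam n k j = 0 := by
  refine if_neg fun h => hj (Finset.mem_Icc.2 ⟨h.1, ?_⟩)
  have h2 := h.2
  rw [boundH, if_neg (by omega), ← Nat.cast_add, Nat.cast_le] at h2
  exact h2

theorem theorem3 (f : ℕ → Polynomial ℝ) (hf : IsBinomialType f) (A : ℕ → ℝ)
    (r s u v : ℕ) (hrs : 1 ≤ r + s) (a α β lam : ℝ) :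
    -- the sequence with `e ^ (α z)`, as power series in an indeterminate `x`
    SatisfiesBell (fun n k => PowerSeries.mk (coeffY f A r s u v a α β lam n k)) ∧
    -- the same at a real `x` where the series for `Y(m,1)` converge absolutely
    (∀ (x : ℝ) (n k : ℕ), 1 ≤ k → k ≤ n →
      (∀ m : ℕ, 1 ≤ m → m ≤ n - k + 1 →
        Summable fun j : ℕ => coeffY f A r s u v a α β lam m 1 j * x ^ j) →
      HasSum (fun j : ℕ => coeffY f A r s u v a α β lam n k j * x ^ j)
        (bellPartial n k fun m => ∑' j : ℕ, coeffY f A r s u v a α β lam m 1 j * x ^ j)) ∧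
    -- the same at a real `x` where all series involved converge, possibly only conditionally
    (∀ (x : ℝ) (n k : ℕ), 1 ≤ k → k ≤ n → ∀ (y : ℕ → ℝ) (L : ℝ),
      (∀ m : ℕ, 1 ≤ m → m ≤ n - k + 1 →
        Filter.Tendsto
          (fun N : ℕ => ∑ j ∈ Finset.range N, coeffY f A r s u v a α β lam m 1 j * x ^ j)
          Filter.atTop (nhds (y m))) →
      Filter.Tendsto
        (fun N : ℕ => ∑ j ∈ Finset.range N, coeffY f A r s u v a α β lam n k j * x ^ j)
        Filter.atTop (nhds L) →
      bellPartial n k y = L) ∧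
    -- the sequence for `α = 0`, as power series in an indeterminate `x`
    SatisfiesBell (fun n k => PowerSeries.mk (coeffYZero f A r s u v a β lam n k)) ∧
    -- for `u ≥ 1` it is given by a finite sum, for every real `x`
    (1 ≤ u → ∀ x : ℝ, SatisfiesBell (fun n k =>
      ∑ j ∈ Finset.Icc (bigT r s n k) ((n - k) / u + bigT r s n k),
        coeffYZero f A r s u v a β lam n k j * x ^ j)) ∧
    -- any `u` (so also `u = 0`), at a real `x` where the series for `Y(m,1)` converge absolutely
    (∀ (x : ℝ) (n k : ℕ), 1 ≤ k → k ≤ n →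
      (∀ m : ℕ, 1 ≤ m → m ≤ n - k + 1 →
        Summable fun j : ℕ => coeffYZero f A r s u v a β lam m 1 j * x ^ j) →
      HasSum (fun j : ℕ => coeffYZero f A r s u v a β lam n k j * x ^ j)
        (bellPartial n k fun m => ∑' j : ℕ, coeffYZero f A r s u v a β lam m 1 j * x ^ j)) ∧
    -- any `u` (so also `u = 0`), at a real `x` where all series involved converge, possibly only conditionally
    (∀ (x : ℝ) (n k : ℕ), 1 ≤ k → k ≤ n → ∀ (y : ℕ → ℝ) (L : ℝ),
      (∀ m : ℕ, 1 ≤ m → m ≤ n - k + 1 →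
        Filter.Tendsto
          (fun N : ℕ => ∑ j ∈ Finset.range N, coeffYZero f A r s u v a β lam m 1 j * x ^ j)
          Filter.atTop (nhds (y m))) →
      Filter.Tendsto
        (fun N : ℕ => ∑ j ∈ Finset.range N, coeffYZero f A r s u v a β lam n k j * x ^ j)
        Filter.atTop (nhds L) →
      bellPartial n k y = L) := by

  have h1 := satisfiesBell_coeffY hf A u v hrs a α β lam
  have h2 := satisfiesBell_coeffYZero hf A u v hrs a β lam
  refine ⟨h1, fun x n k hk hkn => h1.hasSum hk hkn, fun x n k hk hkn y L => h1.eq_of_tendsto hk hkn,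
    h2, fun hu x n k hk hkn => ?_, fun x n k hk hkn => h2.hasSum hk hkn,
    fun x n k hk hkn y L => h2.eq_of_tendsto hk hkn⟩
  -- For `u ≥ 1` the series are finite sums, hence absolutely convergent at every `x`.
  have hfin : ∀ n k, HasSum (fun j : ℕ => coeffYZero f A r s u v a β lam n k j * x ^ j)
      (∑ j ∈ Finset.Icc (bigT r s n k) ((n - k) / u + bigT r s n k),
        coeffYZero f A r s u v a β lam n k j * x ^ j) := fun n k =>
    hasSum_sum_of_ne_finset_zero fun j hj => by
      rw [coeffYZero_eq_zero_of_notMem f A r s v a β lam hu hj, zero_mul]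
  have h := h2.hasSum hk hkn fun m _ _ => (hfin m 1).summable
  simp only [(hfin _ 1).tsum_eq] at h
  exact h.unique (hfin n k)
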